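/- Let $\Bbbk$ be a field, let $N,k,r\ge 0$ be integers, and let $f_0,\dots,f_k\in R=\Bbbk[x_1,\dots,x_N]$ be homogeneous of degree $r$, where $\deg x_i=1$. Put $I=(f_0,\dots,f_k)$, and let $\mathcal R(I)=\bigoplus_{n\ge 0} I^n t^n\subseteq R[t]$ be the Rees algebra of $I$, regarded as a quotient of $S=\Bbbk[x_1,\dots,x_N,w_0,\dots,w_k]$ through $x_i\mapsto x_i$, $w_i\mapsto f_i t$, and bigraded by $\deg x_i=(1,0)$, $\deg w_i=(0,1)$. Write $$\beta_{i,n}(I^d)=\dim_\Bbbk \mathrm{Tor}^R_i(\Bbbk,I^d)_n,\qquad \beta_{i,(j,m)}(\mathcal R(I))=\dim_\Bbbk \mathrm{Tor}^S_i(\Bbbk,\mathcal R(I))_{(j,m)}$$ for the graded and bigraded Betti numbers. Then for all integers $i,d\ge 0$ and all $j\in\mathbb Z$, $$\beta_{i,j+rd}(I^d)\;\le\;\sum_{m=0}^{d}\binom{d+k-m}{d-m}\,\beta_{i,(j,m)}(\mathcal R(I)).$$ -/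

import Mathlib

open MvPolynomial

universe u

noncomputable section

namespace GradedBetti

/-! ### Graded Betti numbers over a polynomial ring

`S = K[x_s : s ∈ σ]` is graded by an abelian group `A` through `deg x_s = w s`, and `M` is an
`S`-module whose homogeneous elements of degree `a` are `𝓜 a`.  The graded Betti number
`β_{i,a}(M) = dim_K Tor_i^S(K, M)_a` is computed as usual: take a graded free resolution of `M`,
tensor it with `K = S / (x_s : s ∈ σ)`, and take the degree `a` part of the `i`-th homology. The
resolution used is the canonical one, in which each free module has one generator for every
nonzero homogeneous element of the module (`M`, then the successive syzygies) to be covered. -/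

variable {K : Type u} [Field K] {σ A : Type} [AddCommGroup A]

/-- A graded free `S`-module `F = ⨁_{g ∈ gens} S(-deg g)`, realised as `gens →₀ S`, with a
submodule of it, to be thought of as the kernel of the map going out of `F`. -/
structure Stage (K : Type u) [Field K] (σ A : Type) where
  /-- the index set of the homogeneous basis -/
  gens : Type u
  /-- the degrees of the basis elements -/
  deg : gens → A
  /-- the syzygies -/
  syz : Submodule (MvPolynomial σ K) (gens →₀ MvPolynomial σ K)

/-- An element `v` of `F = ⨁ S(-deg g)` is homogeneous of degree `a` when its coordinate at each
`g` is homogeneous of degree `a - deg g`. -/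
def Stage.IsHomogeneous (w : σ → A) (T : Stage K σ A) (v : T.gens →₀ MvPolynomial σ K) (a : A) :
    Prop :=
  ∀ g, IsWeightedHomogeneous w (v g) (a - T.deg g)

/-- The first free module of the resolution, with one generator of degree `a` for each nonzero
homogeneous element of `M` of degree `a`. -/
abbrev firstStage {M : Type u} [AddCommGroup M] [Module (MvPolynomial σ K) M]
    (𝓜 : A → AddSubgroup M) : Stage K σ A where
  gens := {p : A × M // p.2 ≠ 0 ∧ p.2 ∈ 𝓜 p.1}
  deg g := g.1.1
  syz := LinearMap.ker (Finsupp.linearCombination (MvPolynomial σ K)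
    fun g : {p : A × M // p.2 ≠ 0 ∧ p.2 ∈ 𝓜 p.1} => g.1.2)

/-- The generators of the next free module: one generator of degree `a` for each nonzero
homogeneous syzygy of degree `a`. -/
abbrev Stage.NextGens (w : σ → A) (T : Stage K σ A) : Type u :=
  {p : A × (T.gens →₀ MvPolynomial σ K) // p.2 ≠ 0 ∧ p.2 ∈ T.syz ∧ T.IsHomogeneous w p.2 p.1}

/-- The differential from the next free module: a generator is sent to the syzygy it names. -/
def Stage.diff (w : σ → A) (T : Stage K σ A) :
    (T.NextGens w →₀ MvPolynomial σ K) →ₗ[MvPolynomial σ K] (T.gens →₀ MvPolynomial σ K) :=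
  Finsupp.linearCombination _ fun g : T.NextGens w => g.1.2

/-- The next free module of the resolution. -/
abbrev Stage.next (w : σ → A) (T : Stage K σ A) : Stage K σ A where
  gens := T.NextGens w
  deg g := g.1.1
  syz := LinearMap.ker (T.diff w)

/-- The differential after applying `K ⊗_S -`, where `K ⊗_S F` is identified with `gens →₀ K`:
the entries of the matrix of the differential are replaced by their constant coefficients. -/
def Stage.diffBar (w : σ → A) (T : Stage K σ A) :
    (T.NextGens w →₀ K) →ₗ[K] (T.gens →₀ K) :=
  Finsupp.linearCombination K fun g : T.NextGens w =>
    Finsupp.mapRange (constantCoeff : MvPolynomial σ K →+* K) (map_zero _) g.1.2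

/-- The degree `a` part of `K ⊗_S F`. -/
def Stage.barPiece (T : Stage K σ A) (a : A) : Submodule K (T.gens →₀ K) :=
  Finsupp.supported K K {g | T.deg g = a}

section Resolution

variable (K) (w : σ → A) {M : Type u} [AddCommGroup M] [Module (MvPolynomial σ K) M]
  (𝓜 : A → AddSubgroup M)

/-- The canonical graded free resolution `⋯ → F_2 → F_1 → F_0 → M`. -/
def resolution : ℕ → Stage K σ A
  | 0 => firstStage 𝓜
  | i + 1 => (resolution i).next w

/-- The cycles of degree `a` in the complex `K ⊗_S F`, in homological degree `i`. -/
def cycles : (i : ℕ) → (a : A) → Submodule K ((resolution K w 𝓜 i).gens →₀ K)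
  | 0, a => (resolution K w 𝓜 0).barPiece a
  | i + 1, a => (resolution K w 𝓜 (i + 1)).barPiece a ⊓ LinearMap.ker ((resolution K w 𝓜 i).diffBar w)

/-- The boundaries of degree `a` in the complex `K ⊗_S F`, in homological degree `i`. -/
def boundaries (i : ℕ) (a : A) : Submodule K ((resolution K w 𝓜 i).gens →₀ K) :=
  ((resolution K w 𝓜 (i + 1)).barPiece a).map ((resolution K w 𝓜 i).diffBar w)

/-- `Tor_i^S(K, M)_a`, the degree `a` part of the homology of `K ⊗_S F`: the image of the cycles in
`(K ⊗_S F_i) / boundaries`. -/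
def torPiece (i : ℕ) (a : A) :
    Submodule K (((resolution K w 𝓜 i).gens →₀ K) ⧸ boundaries K w 𝓜 i a) :=
  (cycles K w 𝓜 i a).map (boundaries K w 𝓜 i a).mkQ

/-- The graded Betti number `β_{i,a}(M) = dim_K Tor_i^S(K, M)_a`. -/
def betti (i : ℕ) (a : A) : Cardinal.{u} :=
  Module.rank K (torPiece K w 𝓜 i a)

end Resolution

/-! ### Ideals of `R = K[x_1, …, x_N]` with the standard grading -/

/-- The homogeneous elements of degree `n` of an ideal of `R`, where `deg x_i = 1`. -/
def idealPiece {N : ℕ} (J : Ideal (MvPolynomial (Fin N) K)) (n : ℤ) : AddSubgroup J :=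
  (weightedHomogeneousSubmodule K (fun _ : Fin N => (1 : ℤ)) n).toAddSubgroup.comap
    (J.subtype : J →+ MvPolynomial (Fin N) K)

/-- `β_{i,n}(J) = dim_K Tor_i^R(K, J)_n` for a homogeneous ideal `J` of `R`. -/
def idealBetti {N : ℕ} (J : Ideal (MvPolynomial (Fin N) K)) (i : ℕ) (n : ℤ) : Cardinal.{u} :=
  betti K (fun _ : Fin N => (1 : ℤ)) (idealPiece J) i n

/-! ### The Rees algebra of `I = (f_0, …, f_k)` as a bigraded module over
`S = K[x_1, …, x_N, w_0, …, w_k]` -/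

section Rees

variable {N k : ℕ} (f : Fin (k + 1) → MvPolynomial (Fin N) K)

/-- The Rees algebra `R ⊕ It ⊕ I²t² ⊕ ⋯ ⊆ R[t]` of `I = (f_0, …, f_k)`. -/
def Rees : Type u := reesAlgebra (Ideal.span (Set.range f))

instance : CommRing (Rees f) := inferInstanceAs (CommRing (reesAlgebra (Ideal.span (Set.range f))))

instance : Algebra (MvPolynomial (Fin N) K) (Rees f) :=
  inferInstanceAs (Algebra (MvPolynomial (Fin N) K) (reesAlgebra (Ideal.span (Set.range f))))

/-- The element `f_i t` of the Rees algebra. -/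
def Rees.ft (i : Fin (k + 1)) : Rees f :=
  ⟨Polynomial.monomial 1 (f i), reesAlgebra.monomial_mem.2
    (by rw [pow_one]; exact Ideal.subset_span ⟨i, rfl⟩)⟩

/-- The presentation `S → R(I)`, `x_i ↦ x_i`, `w_i ↦ f_i t`. -/
def Rees.presentation : MvPolynomial (Fin N ⊕ Fin (k + 1)) K →+* Rees f :=
  eval₂Hom ((algebraMap (MvPolynomial (Fin N) K) (Rees f)).comp C)
    (Sum.elim (fun i => algebraMap (MvPolynomial (Fin N) K) (Rees f) (X i)) (Rees.ft f))

/-- The Rees algebra is an `S`-module through its presentation. -/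
instance : Module (MvPolynomial (Fin N ⊕ Fin (k + 1)) K) (Rees f) :=
  Module.compHom (Rees f) (Rees.presentation f)

/-- The bigrading of `S`: `deg x_i = (1, 0)` and `deg w_i = (0, 1)`. -/
def bideg (N k : ℕ) : Fin N ⊕ Fin (k + 1) → ℤ × ℤ :=
  Sum.elim (fun _ => (1, 0)) (fun _ => (0, 1))

/-- The bigrading of the Rees algebra as a quotient of `S`: the elements of bidegree `a` are the
images of the polynomials of bidegree `a`. -/
def reesPiece (a : ℤ × ℤ) : AddSubgroup (Rees f) :=
  (weightedHomogeneousSubmodule K (bideg N k) a).toAddSubgroup.map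
    (Rees.presentation f : MvPolynomial (Fin N ⊕ Fin (k + 1)) K →+ Rees f)

/-- `β_{i,a}(R(I)) = dim_K Tor_i^S(K, R(I))_a`. -/
def reesBetti (i : ℕ) (a : ℤ × ℤ) : Cardinal.{u} :=
  betti K (bideg N k) (reesPiece f) i a

end Rees

end GradedBetti

end

/-!
Multiplication by `t^d` identifies `I^d` with the strand of `R(I)` in `t`-degree `d`, on which only
the variables `x_i` act. Let `F` be the canonical graded free resolution of `R(I)` over `S`. The
strand of `F` in `t`-degree `d` is a resolution of `I^d` as well, so the comparison map to it from
the canonical resolution of `I^d` over `R` is a quasi-isomorphism. It remains one modulo the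
variables `x_i`: these are regular on both sides, so that they can be killed one at a time, by the
five lemma. Hence `Tor^R(K, I^d)` is the homology of `F / (x_1, …, x_N) F` in `t`-degree `d`.

Write `H` for the homology of `F` modulo some of the variables and `H'` for the homology after
killing one more variable `w_l`. The long exact sequence bounds the dimension of `H` in `t`-degree
`d` by that of `H` in `t`-degree `d - 1` plus that of `H'` in `t`-degree `d`, and `H` vanishes in
negative `t`-degrees. Modulo all variables the homology is `Tor^S(K, R(I))`, and the bounds for
`w_0, …, w_k` add up to binomial coefficients by Pascal's rule.
-/

noncomputable section

namespace GradedBetti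

open CategoryTheory

section Subquotient

variable {R V W : Type*} [Ring R] [AddCommGroup V] [Module R V] [AddCommGroup W] [Module R W]

/-- The image of `P` in `V ⧸ J`, presented as a quotient of `P`. -/
abbrev Subquotient (P J : Submodule R V) : Type _ := P ⧸ J.submoduleOf P

variable {P J : Submodule R V} {P' J' : Submodule R W}

/-- The map of subquotients induced by a linear map. -/
def Subquotient.map (g : V →ₗ[R] W) (hP : P ≤ P'.comap g) (hJ : J ≤ J'.comap g) :
    Subquotient P J →ₗ[R] Subquotient P' J' :=
  (J.submoduleOf P).mapQ (J'.submoduleOf P') (g.restrict hP) fun _ hv => hJ hv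

/-- The class in `Subquotient P J` of an element of `P`. -/
abbrev Subquotient.mk (J : Submodule R V) {P : Submodule R V} (v : P) : Subquotient P J :=
  Submodule.Quotient.mk v

theorem Subquotient.mk_eq_zero {v : P} : mk J v = 0 ↔ (v : V) ∈ J :=
  Submodule.Quotient.mk_eq_zero _

theorem Subquotient.mk_eq_mk {v v' : P} : mk J v = mk J v' ↔ (v : V) - v' ∈ J :=
  Submodule.Quotient.eq _

theorem Subquotient.mk_surjective : Function.Surjective (mk J : P → Subquotient P J) :=
  Submodule.Quotient.mk_surjective _

end Subquotient

section Homology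

theorem rank_le_add_of_exact {K : Type u} [Field K] {S : ShortComplex (ModuleCat.{u} K)}
    (hS : S.Exact) : Module.rank K S.X₂ ≤ Module.rank K S.X₁ + Module.rank K S.X₃ := by
  rw [← LinearMap.rank_range_add_rank_ker S.g.hom, ← hS.moduleCat_range_eq_ker, add_comm]
  exact add_le_add (rank_range_le _) (Submodule.rank_le _)

theorem rank_homology_of_injective {R : Type u} [Ring R] (S : ShortComplex (ModuleCat.{u} R))
    {V : Type u} [AddCommGroup V] [Module R V] {e : S.X₂ →ₗ[R] V} (he : Function.Injective e) :
    Module.rank R S.homology =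
      Module.rank R (((LinearMap.ker S.g.hom).map e).map
        ((LinearMap.range S.f.hom).map e).mkQ) := by
  let B := (LinearMap.range S.f.hom).map e
  let q : LinearMap.ker S.g.hom →ₗ[R] V ⧸ B := B.mkQ ∘ₗ e ∘ₗ (LinearMap.ker S.g.hom).subtype
  have hrange : LinearMap.range q = ((LinearMap.ker S.g.hom).map e).map B.mkQ := by
    rw [LinearMap.range_comp, LinearMap.range_comp, Submodule.range_subtype]
  have hker : LinearMap.ker q = LinearMap.range S.moduleCatToCycles := by
    ext z
    rw [LinearMap.mem_ker, LinearMap.mem_range]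
    refine (Submodule.Quotient.mk_eq_zero B).trans ?_
    constructor
    · rintro ⟨_, ⟨x, rfl⟩, hx⟩
      exact ⟨x, Subtype.ext (he hx)⟩
    · rintro ⟨x, rfl⟩
      exact ⟨_, ⟨x, rfl⟩, rfl⟩
  rw [← hrange, ← q.quotKerEquivRange.rank_eq, hker]
  exact S.moduleCatHomologyIso.toLinearEquiv.rank_eq

theorem quasiIso_of_elementwise {R : Type u} [Ring R] {S T : ShortComplex (ModuleCat.{u} R)}
    (φ : S ⟶ T) (hinj : ∀ x y, S.g x = 0 → T.f y = φ.τ₂ x → ∃ z, S.f z = x)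
    (hsurj : ∀ y, T.g y = 0 → ∃ x z, S.g x = 0 ∧ φ.τ₂ x + T.f z = y) :
    ShortComplex.QuasiIso φ := by
  have hcomm (x : S.X₁) : φ.τ₂ (S.f x) = T.f (φ.τ₁ x) :=
    (ConcreteCategory.congr_hom φ.comm₁₂ x).symm
  let φK : LinearMap.ker S.g.hom →ₗ[R] LinearMap.ker T.g.hom :=
    φ.τ₂.hom.restrict fun x hx =>
      (ConcreteCategory.congr_hom φ.comm₂₃ x).trans ((congrArg φ.τ₃ hx).trans (map_zero φ.τ₃.hom))
  let φH := (LinearMap.range S.moduleCatToCycles).mapQ (LinearMap.range T.moduleCatToCycles) φK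
    (by
      rintro _ ⟨x, rfl⟩
      exact ⟨φ.τ₁ x, Subtype.ext (hcomm x).symm⟩)
  let γ : ShortComplex.LeftHomologyMapData φ S.moduleCatLeftHomologyData
      T.moduleCatLeftHomologyData :=
    { φK := ModuleCat.ofHom φK
      φH := ModuleCat.ofHom φH
      commi := rfl
      commf' := ModuleCat.hom_ext (LinearMap.ext fun x => Subtype.ext (hcomm x))
      commπ := rfl }
  rw [γ.quasiIso_iff, ConcreteCategory.isIso_iff_bijective]
  constructor
  · refine (injective_iff_map_eq_zero φH).2 fun q hq => ?_
    obtain ⟨⟨x, hx⟩, rfl⟩ := Submodule.Quotient.mk_surjective _ q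
    obtain ⟨y, hy⟩ := (Submodule.Quotient.mk_eq_zero _).1 hq
    obtain ⟨z, hz⟩ := hinj x y hx (congrArg Subtype.val hy)
    exact (Submodule.Quotient.mk_eq_zero _).2 ⟨z, Subtype.ext hz⟩
  · intro q
    obtain ⟨⟨y, hy⟩, rfl⟩ := Submodule.Quotient.mk_surjective _ q
    obtain ⟨x, z, hx, h⟩ := hsurj y hy
    refine ⟨Submodule.Quotient.mk ⟨x, hx⟩, Eq.symm ?_⟩
    exact (Submodule.Quotient.eq _).2 ⟨z, Subtype.ext (eq_sub_of_add_eq' h)⟩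

end Homology

/-! ### Reduction of the canonical resolution modulo variables -/

section VarSubmodule

variable {R : Type*} [CommSemiring R] {σ : Type*} {ι ι' : Type*} {J : Set σ} {s : σ}

/-- The submodule `(x_s : s ∈ J) F` of the free module `F = ι →₀ S`, described by coordinates. -/
def varSubmodule (R : Type*) [CommSemiring R] {σ : Type*} (J : Set σ) (ι : Type*) :
    Submodule (MvPolynomial σ R) (ι →₀ MvPolynomial σ R) where
  carrier := {v | ∀ g, v g ∈ Ideal.span (X '' J : Set (MvPolynomial σ R))}
  add_mem' hv hv' g := add_mem (hv g) (hv' g)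
  zero_mem' _ := zero_mem _
  smul_mem' p _ hv g := Ideal.mul_mem_left _ p (hv g)

theorem varSubmodule_empty : varSubmodule R (∅ : Set σ) ι = ⊥ := by
  ext v
  simp [varSubmodule, Finsupp.ext_iff]

theorem varSubmodule_mono {J' : Set σ} (h : J ⊆ J') :
    varSubmodule R J ι ≤ varSubmodule R J' ι :=
  fun _ hv g => Ideal.span_mono (Set.image_mono h) (hv g)

theorem mem_varSubmodule_univ {v : ι →₀ MvPolynomial σ R} :
    v ∈ varSubmodule R Set.univ ι ↔ ∀ g, constantCoeff (v g) = 0 := by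
  refine forall_congr' fun g => ?_
  rw [mem_ideal_span_X_image, constantCoeff_eq]
  constructor
  · intro h
    by_contra h0
    obtain ⟨i, -, hi⟩ := h 0 (mem_support_iff.2 h0)
    exact hi rfl
  · intro h m hm
    by_contra! hzero
    have : m = 0 := Finsupp.ext fun i => hzero i trivial
    exact mem_support_iff.1 hm (this ▸ h)

theorem map_mem_varSubmodule
    (g : (ι →₀ MvPolynomial σ R) →ₗ[MvPolynomial σ R] ι' →₀ MvPolynomial σ R)
    {v : ι →₀ MvPolynomial σ R} (hv : v ∈ varSubmodule R J ι) : g v ∈ varSubmodule R J ι' := by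
  intro i
  rw [← Finsupp.sum_single v, map_finsuppSum, Finsupp.sum, Finsupp.finsetSum_apply]
  refine sum_mem fun j _ => ?_
  rw [← mul_one (v j), ← smul_eq_mul, ← Finsupp.smul_single, map_smul]
  exact Ideal.mul_mem_right _ _ (hv j)

theorem X_smul_mem_varSubmodule (hs : s ∈ J) (v : ι →₀ MvPolynomial σ R) :
    (X s : MvPolynomial σ R) • v ∈ varSubmodule R J ι :=
  fun _ => Ideal.mul_mem_right _ _ (Ideal.subset_span ⟨s, hs, rfl⟩)

theorem mem_varSubmodule_of_X_smul_mem (hs : s ∉ J) {v : ι →₀ MvPolynomial σ R}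
    (h : (X s : MvPolynomial σ R) • v ∈ varSubmodule R J ι) : v ∈ varSubmodule R J ι := by
  intro g
  rw [mem_ideal_span_X_image]
  intro m hm
  obtain ⟨i, hi, hmi⟩ := mem_ideal_span_X_image.1 (h g) (Finsupp.single s 1 + m) (by
    rwa [Finsupp.smul_apply, smul_eq_mul, mem_support_iff, coeff_X_mul, ← mem_support_iff])
  have hsi : s ≠ i := fun h => hs (h ▸ hi)
  exact ⟨i, hi, by simpa [Finsupp.single_apply, hsi] using hmi⟩

/-- The coordinatewise quotient of a vector on division by the variable `X s`. -/
def divX (s : σ) (v : ι →₀ MvPolynomial σ R) : ι →₀ MvPolynomial σ R :=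
  v.mapRange (fun p => p.divMonomial (Finsupp.single s 1)) (zero_divMonomial _)

theorem sub_X_smul_divX_mem_varSubmodule {R : Type*} [CommRing R] {v : ι →₀ MvPolynomial σ R}
    (hv : v ∈ varSubmodule R (insert s J) ι) :
    v - (X s : MvPolynomial σ R) • divX s v ∈ varSubmodule R J ι := by
  intro g
  have hmod : (v - (X s : MvPolynomial σ R) • divX s v) g =
      (v g).modMonomial (Finsupp.single s 1) :=
    sub_eq_of_eq_add' (divMonomial_add_modMonomial_single (v g) s).symm
  rw [hmod, mem_ideal_span_X_image]
  intro m hm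
  rw [mem_support_iff] at hm
  have hle : ¬ Finsupp.single s 1 ≤ m := fun hle => hm (coeff_modMonomial_of_le _ hle)
  rw [coeff_modMonomial_of_not_le _ hle, ← mem_support_iff] at hm
  obtain ⟨i, rfl | hi, hmi⟩ := mem_ideal_span_X_image.1 (hv g) m hm
  · exact absurd (by simpa [Nat.one_le_iff_ne_zero] using hmi) hle
  · exact ⟨i, hi, hmi⟩

theorem isWeightedHomogeneous_divMonomial {A : Type*} [AddCancelCommMonoid A] {w : σ → A}
    {p : MvPolynomial σ R} {a b : A} (hp : IsWeightedHomogeneous w p a) {μ : σ →₀ ℕ}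
    (hb : Finsupp.weight w μ + b = a) : IsWeightedHomogeneous w (p.divMonomial μ) b := by
  intro m hm
  rw [coeff_divMonomial] at hm
  exact add_left_cancel ((map_add _ _ _).symm.trans ((hp hm).trans hb.symm))

end VarSubmodule

namespace Stage

variable {K : Type u} [Field K] {σ A : Type} [AddCommGroup A] {w : σ → A} {T T' : Stage K σ A}
  {a b : A}

/-- The elements of degree `a` of the graded free module of a stage. -/
def homogeneousSubmodule (w : σ → A) (T : Stage K σ A) (a : A) :
    Submodule K (T.gens →₀ MvPolynomial σ K) where
  carrier := {v | T.IsHomogeneous w v a}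
  add_mem' hv hv' g := (hv g).add (hv' g)
  zero_mem' _ := isWeightedHomogeneous_zero _ _ _
  smul_mem' c _ hv g := (weightedHomogeneousSubmodule K w _).smul_mem c (hv g)

theorem isHomogeneous_single (g : T.gens) : T.IsHomogeneous w (Finsupp.single g 1) (T.deg g) := by
  classical
  intro g'
  rw [Finsupp.single_apply]
  split_ifs with h
  · rw [h, sub_self]
    exact isWeightedHomogeneous_one K w
  · exact isWeightedHomogeneous_zero _ _ _

theorem isHomogeneous_smul {p : MvPolynomial σ K} {v : T.gens →₀ MvPolynomial σ K}
    (hp : IsWeightedHomogeneous w p b) (hv : T.IsHomogeneous w v a) :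
    T.IsHomogeneous w (p • v) (b + a) := fun g => by
  rw [add_sub_assoc]
  exact hp.mul (hv g)

theorem isHomogeneous_divX {s : σ} (hab : w s + b = a) {v : T.gens →₀ MvPolynomial σ K}
    (hv : T.IsHomogeneous w v a) : T.IsHomogeneous w (divX s v) b := fun g =>
  isWeightedHomogeneous_divMonomial (hv g) (by
    rw [Finsupp.weight_single, one_smul, ← add_sub_assoc, hab])

theorem isHomogeneous_diff {v : T.NextGens w →₀ MvPolynomial σ K}
    (hv : (T.next w).IsHomogeneous w v a) : T.IsHomogeneous w (T.diff w v) a := by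
  rw [diff, Finsupp.linearCombination_apply]
  refine (T.homogeneousSubmodule w a).sum_mem fun g _ => ?_
  have := isHomogeneous_smul (hv g) g.2.2.2
  rwa [sub_add_cancel] at this

variable (w) in
theorem diff_mem_syz (v : T.NextGens w →₀ MvPolynomial σ K) : T.diff w v ∈ T.syz := by
  rw [diff, Finsupp.linearCombination_apply]
  exact T.syz.sum_mem fun g _ => T.syz.smul_mem _ g.2.2.1

theorem diff_single (g : T.NextGens w) (p : MvPolynomial σ K) :
    T.diff w (Finsupp.single g p) = p • g.1.2 := by
  rw [diff, Finsupp.linearCombination_single]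

open Classical in
/-- The basis vector of the next free module which covers the homogeneous syzygy `v` of degree `a`
(zero when `v` is not such a syzygy). -/
def cover (w : σ → A) (T : Stage K σ A) (a : A) (v : T.gens →₀ MvPolynomial σ K) :
    T.NextGens w →₀ MvPolynomial σ K :=
  if h : v ≠ 0 ∧ v ∈ T.syz ∧ T.IsHomogeneous w v a then Finsupp.single ⟨(a, v), h⟩ 1 else 0

theorem diff_cover {v : T.gens →₀ MvPolynomial σ K} (hv : v ∈ T.syz)
    (ha : T.IsHomogeneous w v a) : T.diff w (T.cover w a v) = v := by
  by_cases h : v = 0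
  · rw [cover, dif_neg (fun h' => h'.1 h), map_zero, h]
  · rw [cover, dif_pos ⟨h, hv, ha⟩, diff_single, one_smul]

theorem isHomogeneous_cover (v : T.gens →₀ MvPolynomial σ K) :
    (T.next w).IsHomogeneous w (T.cover w a v) a := by
  rw [cover]
  split_ifs with h
  · exact isHomogeneous_single (T := T.next w) ⟨(a, v), h⟩
  · exact ((T.next w).homogeneousSubmodule w a).zero_mem

end Stage

section ReducedComplex

variable {K : Type u} [Field K] {σ A : Type} [AddCommGroup A] {w : σ → A}
  {M : Type u} [AddCommGroup M] [Module (MvPolynomial σ K) M] {𝓜 : A → AddSubgroup M}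

variable (K w 𝓜) in
/-- The differential of the canonical resolution. -/
def resolutionDiff (i : ℕ) :
    ((resolution K w 𝓜 (i + 1)).gens →₀ MvPolynomial σ K) →ₗ[MvPolynomial σ K]
      (resolution K w 𝓜 i).gens →₀ MvPolynomial σ K :=
  (resolution K w 𝓜 i).diff w

theorem resolutionDiff_comp_resolutionDiff (i : ℕ)
    (v : (resolution K w 𝓜 (i + 2)).gens →₀ MvPolynomial σ K) :
    resolutionDiff K w 𝓜 i (resolutionDiff K w 𝓜 (i + 1) v) = 0 :=
  (resolution K w 𝓜 (i + 1)).diff_mem_syz w v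

variable (K w 𝓜) in
/-- The degree `a` part of `F_i / (x_s : s ∈ J) F_i`, where `F` is the canonical resolution. -/
abbrev ReducedPiece (J : Set σ) (a : A) (i : ℕ) : Type u :=
  Subquotient ((resolution K w 𝓜 i).homogeneousSubmodule w a)
    ((varSubmodule K J (resolution K w 𝓜 i).gens).restrictScalars K)

variable (K w 𝓜) in
/-- The differential of the canonical resolution modulo the variables in `J`, in degree `a`. -/
def reducedDiff (J : Set σ) (a : A) (i : ℕ) :
    ReducedPiece K w 𝓜 J a (i + 1) →ₗ[K] ReducedPiece K w 𝓜 J a i :=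
  Subquotient.map ((resolutionDiff K w 𝓜 i).restrictScalars K) (fun _ => Stage.isHomogeneous_diff)
    (fun _ => map_mem_varSubmodule (resolutionDiff K w 𝓜 i))

theorem reducedDiff_comp_reducedDiff (J : Set σ) (a : A) (i : ℕ) :
    reducedDiff K w 𝓜 J a i ∘ₗ reducedDiff K w 𝓜 J a (i + 1) = 0 := by
  ext v
  exact congrArg (Subquotient.mk _) (Subtype.ext (resolutionDiff_comp_resolutionDiff i v.1))

variable (K w 𝓜) in
/-- The degree `a` part of `F / (x_s : s ∈ J) F`, where `F` is the canonical resolution. -/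
def reducedComplex (J : Set σ) (a : A) : ChainComplex (ModuleCat.{u} K) ℕ :=
  ChainComplex.of (fun i => ModuleCat.of K (ReducedPiece K w 𝓜 J a i))
    (fun i => ModuleCat.ofHom (reducedDiff K w 𝓜 J a i))
    fun i => ModuleCat.hom_ext (reducedDiff_comp_reducedDiff J a i)

theorem reducedComplex_d (J : Set σ) (a : A) (i : ℕ) :
    (reducedComplex K w 𝓜 J a).d (i + 1) i = ModuleCat.ofHom (reducedDiff K w 𝓜 J a i) :=
  ChainComplex.of_d (fun i => ModuleCat.of K (ReducedPiece K w 𝓜 J a i))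
    (fun i => ModuleCat.ofHom (reducedDiff K w 𝓜 J a i)) i

theorem reducedComplex_exists_rep {J : Set σ} {a : A} {i : ℕ}
    (x : (reducedComplex K w 𝓜 J a).X i) :
    ∃ v, (Subquotient.mk _ v : ReducedPiece K w 𝓜 J a i) = x :=
  Subquotient.mk_surjective (J := (varSubmodule K J _).restrictScalars K) x

variable (K w 𝓜) in
/-- The dimension of the degree `a` part of the homology of `F / (x_s : s ∈ J) F`, where `F` is the
canonical resolution. -/
def reducedBetti (J : Set σ) (i : ℕ) (a : A) : Cardinal.{u} :=
  Module.rank K ((reducedComplex K w 𝓜 J a).homology i)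

section Map

variable {τ A' : Type} [AddCommGroup A'] {w' : τ → A'}
  {M' : Type u} [AddCommGroup M'] [Module (MvPolynomial τ K) M'] {𝓜' : A' → AddSubgroup M'}

/-- The map of reduced complexes induced by linear maps between the canonical resolutions, which
need not be linear over the polynomial rings. -/
def reducedMap {J : Set σ} {J' : Set τ} {a : A} {a' : A'}
    (g : ∀ i, ((resolution K w 𝓜 i).gens →₀ MvPolynomial σ K) →ₗ[K]
      (resolution K w' 𝓜' i).gens →₀ MvPolynomial τ K)
    (hdeg : ∀ i v, (resolution K w 𝓜 i).IsHomogeneous w v a →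
      (resolution K w' 𝓜' i).IsHomogeneous w' (g i v) a')
    (hvar : ∀ i, ∀ v ∈ varSubmodule K J _, g i v ∈ varSubmodule K J' _)
    (hdiff : ∀ i v, resolutionDiff K w' 𝓜' i (g (i + 1) v) = g i (resolutionDiff K w 𝓜 i v)) :
    reducedComplex K w 𝓜 J a ⟶ reducedComplex K w' 𝓜' J' a' :=
  ChainComplex.ofHom (fun i => ModuleCat.ofHom (Subquotient.map (g i) (hdeg i) (hvar i)))
    fun i => by
      rw [reducedComplex_d, reducedComplex_d]
      refine ModuleCat.hom_ext (LinearMap.ext fun x => ?_)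
      obtain ⟨v, rfl⟩ := reducedComplex_exists_rep x
      exact congrArg (Subquotient.mk _) (Subtype.ext (hdiff i v.1))

end Map

section Variable

variable {J J' : Set σ} {a b : A} {s : σ}

variable (K 𝓜) in
/-- Multiplication by the variable `X s`, which raises degrees by `w s`. -/
def mulVar (J : Set σ) (hab : w s + b = a) :
    reducedComplex K w 𝓜 J b ⟶ reducedComplex K w 𝓜 J a :=
  reducedMap (fun _ => (LinearMap.lsmul (MvPolynomial σ K) _ (X s)).restrictScalars K)
    (fun _ _ hv => hab ▸ Stage.isHomogeneous_smul (isWeightedHomogeneous_X K w s) hv)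
    (fun _ _ hv => (varSubmodule K J _).smul_mem (X s) hv)
    fun i v => map_smul (resolutionDiff K w 𝓜 i) (X s) v

variable (K 𝓜) in
/-- The projection modulo further variables. -/
def reducedProj (a : A) (hJ : J ⊆ J') :
    reducedComplex K w 𝓜 J a ⟶ reducedComplex K w 𝓜 J' a :=
  reducedMap (fun _ => LinearMap.id) (fun _ _ hv => hv) (fun _ => varSubmodule_mono hJ)
    fun _ _ => rfl

variable (K 𝓜) in
/-- The sequence `F/JF(-w s) → F/JF → F/J'F` in degree `a`, where `J' = J ∪ {s}`. -/
def variableSequence (hJ : insert s J = J') (hab : w s + b = a) :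
    ShortComplex (ChainComplex (ModuleCat.{u} K) ℕ) where
  f := mulVar K 𝓜 J hab
  g := reducedProj K 𝓜 a (hJ ▸ Set.subset_insert s J)
  zero := by
    ext i x
    obtain ⟨v, rfl⟩ := reducedComplex_exists_rep x
    refine Subquotient.mk_eq_zero.2 ?_
    exact X_smul_mem_varSubmodule (hJ ▸ Set.mem_insert s J) v.1

theorem variableSequence_shortExact (hs : s ∉ J) (hJ : insert s J = J') (hab : w s + b = a) :
    (variableSequence K 𝓜 hJ hab).ShortExact := by
  refine HomologicalComplex.shortExact_of_degreewise_shortExact _ fun i =>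
    ModuleCat.shortComplex_shortExact _ ?_ ?_ ?_
  · intro x
    obtain ⟨v, rfl⟩ := reducedComplex_exists_rep x
    constructor
    · intro hv
      have hv : v.1 ∈ varSubmodule K (insert s J) _ := hJ ▸ Subquotient.mk_eq_zero.1 hv
      refine ⟨Subquotient.mk _ ⟨divX s v.1, Stage.isHomogeneous_divX hab v.2⟩, ?_⟩
      exact Eq.symm (Subquotient.mk_eq_mk.2 (sub_X_smul_divX_mem_varSubmodule hv))
    · rintro ⟨y, hy⟩
      obtain ⟨u, rfl⟩ := Subquotient.mk_surjective y
      rw [← hy]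
      refine Subquotient.mk_eq_zero.2 ?_
      exact X_smul_mem_varSubmodule (hJ ▸ Set.mem_insert s J) u.1
  · refine (injective_iff_map_eq_zero _).2 fun x hx => ?_
    obtain ⟨v, rfl⟩ := reducedComplex_exists_rep x
    exact Subquotient.mk_eq_zero.2
      (mem_varSubmodule_of_X_smul_mem hs (Subquotient.mk_eq_zero.1 hx))
  · intro x
    obtain ⟨v, rfl⟩ := reducedComplex_exists_rep x
    exact ⟨Subquotient.mk _ v, rfl⟩

theorem reducedBetti_le_add (hs : s ∉ J) (hab : w s + b = a) (i : ℕ) :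
    reducedBetti K w 𝓜 J i a ≤
      reducedBetti K w 𝓜 J i b + reducedBetti K w 𝓜 (insert s J) i a :=
  rank_le_add_of_exact ((variableSequence_shortExact hs rfl hab).homology_exact₂ i)

end Variable

end ReducedComplex

section ConstantPart

variable {K : Type u} [Field K] {σ A : Type} [AddCommGroup A] {w : σ → A}

/-- The map `F → K ⊗_S F` for a free module `F = ι →₀ S`, where `K ⊗_S F` is identified with
`ι →₀ K`. -/
def constantPart (K : Type*) [Field K] (σ ι : Type*) :
    (ι →₀ MvPolynomial σ K) →ₗ[K] ι →₀ K :=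
  Finsupp.mapRange.linearMap (lcoeff K 0)

theorem mem_varSubmodule_univ_iff_constantPart {ι : Type*} {v : ι →₀ MvPolynomial σ K} :
    v ∈ varSubmodule K Set.univ ι ↔ constantPart K σ ι v = 0 :=
  mem_varSubmodule_univ.trans (Finsupp.ext_iff (f := constantPart K σ ι v) (g := 0)).symm

namespace Stage

variable {T : Stage K σ A}

theorem constantPart_diff (v : T.NextGens w →₀ MvPolynomial σ K) :
    constantPart K σ _ (T.diff w v) = T.diffBar w (constantPart K σ _ v) := by
  induction v using Finsupp.induction_linear with
  | zero => simp only [map_zero]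
  | add v v' h h' => simp only [map_add, h, h']
  | single g p =>
    have : constantPart K σ _ (Finsupp.single g p) = Finsupp.single g (constantCoeff p) :=
      Finsupp.mapRange_single (hf := map_zero _)
    rw [this, diff_single, diffBar, Finsupp.linearCombination_single]
    ext g'
    exact map_mul constantCoeff p (g.1.2 g')

theorem map_constantPart_homogeneousSubmodule (a : A) :
    (T.homogeneousSubmodule w a).map (constantPart K σ _) = T.barPiece a := by
  apply le_antisymm
  · rintro _ ⟨v, hv, rfl⟩
    refine (Finsupp.mem_supported _ _).2 fun g hg => ?_
    have hdeg := hv g (Finsupp.mem_support_iff (f := constantPart K σ _ v).1 hg)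
    exact (sub_eq_zero.1 (hdeg.symm.trans (map_zero _))).symm
  · intro v hv
    refine ⟨Finsupp.mapRange.linearMap (Algebra.linearMap K (MvPolynomial σ K)) v, fun g => ?_, ?_⟩
    · by_cases h : v g = 0
      · simpa only [Finsupp.mapRange.linearMap_apply, Finsupp.mapRange_apply, h, map_zero] using
          isWeightedHomogeneous_zero _ _ _
      · rw [show T.deg g = a from (Finsupp.mem_supported _ _).1 hv (Finsupp.mem_support_iff.2 h),
          sub_self]
        exact isWeightedHomogeneous_C _ _
    · ext g
      exact coeff_zero_C _

end Stage

variable {M : Type u} [AddCommGroup M] [Module (MvPolynomial σ K) M] {𝓜 : A → AddSubgroup M}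

variable (K w 𝓜) in
/-- The differential of `K ⊗_S F`, where `F` is the canonical resolution. -/
def resolutionDiffBar (i : ℕ) :
    ((resolution K w 𝓜 (i + 1)).gens →₀ K) →ₗ[K] (resolution K w 𝓜 i).gens →₀ K :=
  (resolution K w 𝓜 i).diffBar w

variable (K w 𝓜) in
/-- The identification of `F_i / (x_s : s ∈ σ) F_i` in degree `a` with a part of `K ⊗_S F_i`, where
`F` is the canonical resolution. -/
def constantPartUniv (a : A) (i : ℕ) :
    ReducedPiece K w 𝓜 Set.univ a i →ₗ[K] (resolution K w 𝓜 i).gens →₀ K :=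
  Submodule.liftQ _ ((constantPart K σ _).domRestrict _) fun _ hv =>
    mem_varSubmodule_univ_iff_constantPart.1 hv

theorem constantPartUniv_injective (a : A) (i : ℕ) :
    Function.Injective (constantPartUniv K w 𝓜 a i) := by
  refine (injective_iff_map_eq_zero _).2 fun x hx => ?_
  obtain ⟨v, rfl⟩ := Subquotient.mk_surjective x
  exact Subquotient.mk_eq_zero.2 (mem_varSubmodule_univ_iff_constantPart.2 hx)

theorem range_constantPartUniv (a : A) (i : ℕ) :
    LinearMap.range (constantPartUniv K w 𝓜 a i) = (resolution K w 𝓜 i).barPiece a := by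
  refine (Submodule.range_liftQ _ _ _).trans ?_
  rw [LinearMap.range_domRestrict, Stage.map_constantPart_homogeneousSubmodule]

theorem constantPartUniv_comp_reducedDiff (a : A) (i : ℕ) :
    constantPartUniv K w 𝓜 a i ∘ₗ reducedDiff K w 𝓜 Set.univ a i =
      resolutionDiffBar K w 𝓜 i ∘ₗ constantPartUniv K w 𝓜 a (i + 1) := by
  ext1
  exact LinearMap.ext fun v => Stage.constantPart_diff v.1

theorem map_range_reducedDiff (a : A) (i : ℕ) :
    (LinearMap.range (reducedDiff K w 𝓜 Set.univ a i)).map (constantPartUniv K w 𝓜 a i) =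
      boundaries K w 𝓜 i a := by
  rw [← LinearMap.range_comp, constantPartUniv_comp_reducedDiff, LinearMap.range_comp,
    range_constantPartUniv]
  rfl

theorem map_ker_reducedDiff (a : A) (i : ℕ) :
    (LinearMap.ker (reducedDiff K w 𝓜 Set.univ a i)).map (constantPartUniv K w 𝓜 a (i + 1)) =
      cycles K w 𝓜 (i + 1) a := by
  have hker : LinearMap.ker (reducedDiff K w 𝓜 Set.univ a i) =
      (LinearMap.ker (resolutionDiffBar K w 𝓜 i)).comap (constantPartUniv K w 𝓜 a (i + 1)) := by
    rw [← LinearMap.ker_comp, ← constantPartUniv_comp_reducedDiff,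
      LinearMap.ker_comp_of_ker_eq_bot _ (LinearMap.ker_eq_bot.2 (constantPartUniv_injective a i))]
  rw [hker, Submodule.map_comap_eq, range_constantPartUniv]
  rfl

theorem betti_eq_reducedBetti_of_map_ker {i j : ℕ} {a : A}
    (hj : (ComplexShape.down ℕ).next i = j)
    (hcycles : (LinearMap.ker ((reducedComplex K w 𝓜 Set.univ a).d i j).hom).map
      (constantPartUniv K w 𝓜 a i) = cycles K w 𝓜 i a) :
    betti K w 𝓜 i a = reducedBetti K w 𝓜 Set.univ i a := by
  let C := reducedComplex K w 𝓜 Set.univ a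
  have hboundaries : (LinearMap.range (C.d (i + 1) i).hom).map (constantPartUniv K w 𝓜 a i) =
      boundaries K w 𝓜 i a :=
    (congrArg (fun f => (LinearMap.range f.hom).map (constantPartUniv K w 𝓜 a i))
      (reducedComplex_d Set.univ a i)).trans (map_range_reducedDiff a i)
  rw [betti, torPiece, ← hcycles, ← hboundaries]
  exact (rank_homology_of_injective (C.sc' (i + 1) i j) (constantPartUniv_injective a i)).symm.trans
    (C.homologyIsoSc' (i + 1) i j (by simp) hj).toLinearEquiv.rank_eq.symm

theorem betti_eq_reducedBetti (i : ℕ) (a : A) :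
    betti K w 𝓜 i a = reducedBetti K w 𝓜 Set.univ i a := by
  cases i with
  | zero =>
    refine betti_eq_reducedBetti_of_map_ker (j := 0) (by simp) ?_
    rw [(reducedComplex K w 𝓜 Set.univ a).shape 0 0 (by simp), ModuleCat.hom_zero,
      LinearMap.ker_zero]
    exact (Submodule.map_top _).trans (range_constantPartUniv a 0)
  | succ i =>
    refine betti_eq_reducedBetti_of_map_ker (j := i) (by simp) ?_
    rw [reducedComplex_d]
    exact map_ker_reducedDiff a i

end ConstantPart

/-! ### Comparison with the resolution of a strand -/

section Rename

variable {R : Type*} [CommSemiring R] {τ σ : Type*} {φ : τ → σ}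

theorem isWeightedHomogeneous_rename {A' A : Type*} [AddCommMonoid A'] [AddCommMonoid A]
    {w' : τ → A'} {w : σ → A} {β : A' →+ A} (h : ∀ s, w (φ s) = β (w' s)) {p : MvPolynomial τ R}
    {a : A'} (hp : IsWeightedHomogeneous w' p a) :
    IsWeightedHomogeneous w (rename φ p) (β a) := by
  intro m hm
  obtain ⟨m', rfl, hm'⟩ := coeff_rename_ne_zero _ _ _ hm
  rw [← hp hm', Finsupp.weight_apply, Finsupp.weight_apply,
    Finsupp.sum_mapDomain_index (by simp) (by simp [add_smul]), map_finsuppSum]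
  simp only [h, map_nsmul]

variable {ι ι' : Type*} {e : ι → ι' →₀ MvPolynomial σ R}

/-- The map of free modules, semilinear along `rename φ`, which sends the basis to `e`. -/
def renameCombination (φ : τ → σ) (e : ι → ι' →₀ MvPolynomial σ R) :
    (ι →₀ MvPolynomial τ R) →ₗ[R] ι' →₀ MvPolynomial σ R :=
  (Finsupp.linearCombination (MvPolynomial σ R) e).restrictScalars R ∘ₗ
    Finsupp.mapRange.linearMap (rename φ : MvPolynomial τ R →ₐ[R] MvPolynomial σ R).toLinearMap

theorem renameCombination_apply (v : ι →₀ MvPolynomial τ R) :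
    renameCombination φ e v = v.sum fun g p => rename φ p • e g :=
  Finsupp.sum_mapRange_index (hf := map_zero _) fun _ => zero_smul _ _

theorem renameCombination_single (g : ι) (p : MvPolynomial τ R) :
    renameCombination φ e (Finsupp.single g p) = rename φ p • e g := by
  rw [renameCombination_apply, Finsupp.sum_single_index (by rw [map_zero, zero_smul])]

theorem renameCombination_smul (p : MvPolynomial τ R) (v : ι →₀ MvPolynomial τ R) :
    renameCombination φ e (p • v) = rename φ p • renameCombination φ e v := by
  induction v using Finsupp.induction_linear with
  | zero => simp only [smul_zero, map_zero]
  | add v v' h h' => rw [smul_add, map_add, h, h', map_add, smul_add]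
  | single g q => rw [Finsupp.smul_single, renameCombination_single, renameCombination_single,
      smul_eq_mul, map_mul, mul_smul]

theorem renameCombination_mem_varSubmodule {J : Set τ} {v : ι →₀ MvPolynomial τ R}
    (hv : v ∈ varSubmodule R J ι) : renameCombination φ e v ∈ varSubmodule R (φ '' J) ι' := by
  refine map_mem_varSubmodule (Finsupp.linearCombination _ e) fun g => ?_
  have hmap : (Ideal.span (X '' J : Set (MvPolynomial τ R))).map (rename φ : _ →ₐ[R] _) =
      Ideal.span (X '' (φ '' J) : Set (MvPolynomial σ R)) := by
    rw [Ideal.map_span, Set.image_image, Set.image_image]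
    simp only [rename_X]
  exact hmap ▸ Ideal.mem_map_of_mem _ (hv g)

end Rename

section Augmentation

variable {K : Type u} [Field K] {σ A : Type} [AddCommGroup A] {w : σ → A}
  {M : Type u} [AddCommGroup M] [Module (MvPolynomial σ K) M] {𝓜 : A → AddSubgroup M}
  {a : A} {m : M}

variable (K w 𝓜) in
/-- The map `F_0 → M` from the first free module of the canonical resolution. -/
def augmentation :
    ((resolution K w 𝓜 0).gens →₀ MvPolynomial σ K) →ₗ[MvPolynomial σ K] M :=
  Finsupp.linearCombination _ fun g : (resolution K w 𝓜 0).gens => g.1.2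

open Classical in
variable (K w 𝓜) in
/-- The basis vector of the first free module which covers the homogeneous element `m` of degree `a`
(zero when `m` is not such an element). -/
def firstCover (a : A) (m : M) : (resolution K w 𝓜 0).gens →₀ MvPolynomial σ K :=
  if h : m ≠ 0 ∧ m ∈ 𝓜 a then Finsupp.single ⟨(a, m), h⟩ 1 else 0

theorem augmentation_single (g : (resolution K w 𝓜 0).gens) (p : MvPolynomial σ K) :
    augmentation K w 𝓜 (Finsupp.single g p) = p • g.1.2 := by
  rw [augmentation, Finsupp.linearCombination_single]

theorem augmentation_firstCover (ha : m ∈ 𝓜 a) :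
    augmentation K w 𝓜 (firstCover K w 𝓜 a m) = m := by
  by_cases h : m = 0
  · rw [firstCover, dif_neg (fun h' => h'.1 h), map_zero, h]
  · rw [firstCover, dif_pos ⟨h, ha⟩]
    exact (augmentation_single _ _).trans (one_smul _ m)

theorem isHomogeneous_firstCover :
    (resolution K w 𝓜 0).IsHomogeneous w (firstCover K w 𝓜 a m) a := by
  rw [firstCover]
  split_ifs with h
  · exact Stage.isHomogeneous_single (T := resolution K w 𝓜 0) ⟨(a, m), h⟩
  · exact ((resolution K w 𝓜 0).homogeneousSubmodule w a).zero_mem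

end Augmentation

/-- An identification `map` of `M` with a strand of the graded module `M'`, along an inclusion `var`
of the variables which acts by `deg` on degrees: degree `a` in `M` corresponds to degree
`deg a + shift` in `M'`. -/
structure StrandEquiv {K : Type u} [Field K] {τ σ A' A : Type} [AddCommGroup A'] [AddCommGroup A]
    (w' : τ → A') (w : σ → A) {M : Type u} [AddCommGroup M] [Module (MvPolynomial τ K) M]
    {M' : Type u} [AddCommGroup M'] [Module (MvPolynomial σ K) M'] (𝓜 : A' → AddSubgroup M)
    (𝓜' : A → AddSubgroup M') where
  /-- the inclusion of the variables -/
  var : τ → σ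
  /-- the effect on the degrees of polynomials -/
  deg : A' →+ A
  /-- the degree in `M'` of the strand -/
  shift : A
  /-- the identification of `M` with the strand -/
  map : M →+ M'
  var_injective : Function.Injective var
  weight_var : ∀ s, w (var s) = deg (w' s)
  map_smul : ∀ (p : MvPolynomial τ K) m, map (p • m) = rename var p • map m
  map_injective : Function.Injective map
  map_piece : ∀ a, (𝓜 a).map map = 𝓜' (deg a + shift)
  smul_mem : ∀ {a b} {p : MvPolynomial σ K}, IsWeightedHomogeneous w p b → ∀ {m}, m ∈ 𝓜' a →
    p • m ∈ 𝓜' (b + a)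

namespace StrandEquiv

variable {K : Type u} [Field K] {τ σ A' A : Type} [AddCommGroup A'] [AddCommGroup A]
  {w' : τ → A'} {w : σ → A} {M : Type u} [AddCommGroup M] [Module (MvPolynomial τ K) M]
  {M' : Type u} [AddCommGroup M'] [Module (MvPolynomial σ K) M'] {𝓜 : A' → AddSubgroup M}
  {𝓜' : A → AddSubgroup M'} (h : StrandEquiv (K := K) w' w 𝓜 𝓜')

/-- The degree in `M'` which corresponds to the degree `a` in `M`. -/
def degree (a : A') : A := h.deg a + h.shift

theorem degree_add (a b : A') : h.degree (a + b) = h.deg a + h.degree b := by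
  rw [degree, degree, map_add, add_assoc]

theorem map_mem {a : A'} {m : M} (hm : m ∈ 𝓜 a) : h.map m ∈ 𝓜' (h.degree a) :=
  h.map_piece a ▸ AddSubgroup.mem_map_of_mem h.map hm

theorem weight_var_add_degree {s : τ} {a b : A'} (hab : w' s + b = a) :
    w (h.var s) + h.degree b = h.degree a := by
  rw [h.weight_var, ← h.degree_add, hab]

theorem isHomogeneous_renameCombination {T : Stage K τ A'} {T' : Stage K σ A}
    {e : T.gens → T'.gens →₀ MvPolynomial σ K}
    (he : ∀ g, T'.IsHomogeneous w (e g) (h.degree (T.deg g))) {a : A'}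
    {v : T.gens →₀ MvPolynomial τ K} (hv : T.IsHomogeneous w' v a) :
    T'.IsHomogeneous w (renameCombination h.var e v) (h.degree a) := by
  rw [renameCombination_apply]
  refine (T'.homogeneousSubmodule w (h.degree a)).sum_mem fun g _ => ?_
  have := Stage.isHomogeneous_smul (isWeightedHomogeneous_rename h.weight_var (hv g)) (he g)
  rwa [← h.degree_add, sub_add_cancel] at this

/-- The images of the generators under the comparison map of canonical resolutions. -/
def comparisonGen : ∀ i, (resolution K w' 𝓜 i).gens →
    (resolution K w 𝓜' i).gens →₀ MvPolynomial σ K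
  | 0 => fun g => firstCover K w 𝓜' (h.degree g.1.1) (h.map g.1.2)
  | i + 1 => fun g => (resolution K w 𝓜' i).cover w (h.degree g.1.1)
      (renameCombination h.var (comparisonGen i) g.1.2)

/-- The comparison map of canonical resolutions which lifts `h.map`. -/
def comparison (i : ℕ) : ((resolution K w' 𝓜 i).gens →₀ MvPolynomial τ K) →ₗ[K]
    (resolution K w 𝓜' i).gens →₀ MvPolynomial σ K :=
  renameCombination h.var (h.comparisonGen i)

theorem isHomogeneous_comparison (i : ℕ) {a : A'}
    {v : (resolution K w' 𝓜 i).gens →₀ MvPolynomial τ K}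
    (hv : (resolution K w' 𝓜 i).IsHomogeneous w' v a) :
    (resolution K w 𝓜' i).IsHomogeneous w (h.comparison i v) (h.degree a) := by
  refine h.isHomogeneous_renameCombination (fun g => ?_) hv
  cases i with
  | zero => exact isHomogeneous_firstCover
  | succ i => exact Stage.isHomogeneous_cover (T := resolution K w 𝓜' i) _

theorem augmentation_comparison (v : (resolution K w' 𝓜 0).gens →₀ MvPolynomial τ K) :
    augmentation K w 𝓜' (h.comparison 0 v) = h.map (augmentation K w' 𝓜 v) := by
  induction v using Finsupp.induction_linear with
  | zero => simp only [map_zero]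
  | add v v' hv hv' => simp only [map_add, hv, hv']
  | single g p =>
    have hcover : augmentation K w 𝓜' (h.comparisonGen 0 g) = h.map g.1.2 :=
      augmentation_firstCover (h.map_mem g.2.2)
    rw [comparison, renameCombination_single, LinearMap.map_smul, hcover, ← h.map_smul]
    exact congrArg h.map (augmentation_single g p).symm

theorem resolutionDiff_comparison_of_mem_syz {i : ℕ}
    (hsyz : ∀ v ∈ (resolution K w' 𝓜 i).syz, h.comparison i v ∈ (resolution K w 𝓜' i).syz)
    (v : (resolution K w' 𝓜 (i + 1)).gens →₀ MvPolynomial τ K) :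
    resolutionDiff K w 𝓜' i (h.comparison (i + 1) v) =
      h.comparison i (resolutionDiff K w' 𝓜 i v) := by
  induction v using Finsupp.induction_linear with
  | zero => simp only [map_zero]
  | add v v' hv hv' => simp only [map_add, hv, hv']
  | single g p =>
    have hcover : resolutionDiff K w 𝓜' i (h.comparisonGen (i + 1) g) = h.comparison i g.1.2 :=
      Stage.diff_cover (hsyz _ g.2.2.1) (h.isHomogeneous_comparison i g.2.2.2)
    rw [comparison, renameCombination_single, LinearMap.map_smul, hcover, comparison,
      ← renameCombination_smul]
    exact congrArg (h.comparison i) (Stage.diff_single g p).symm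

theorem comparison_mem_syz (i : ℕ) :
    ∀ v ∈ (resolution K w' 𝓜 i).syz, h.comparison i v ∈ (resolution K w 𝓜' i).syz := by
  induction i with
  | zero =>
    intro v hv
    exact (h.augmentation_comparison v).trans ((congrArg h.map hv).trans (map_zero h.map))
  | succ i ih =>
    intro v hv
    exact (h.resolutionDiff_comparison_of_mem_syz ih v).trans
      ((congrArg (h.comparison i) hv).trans (map_zero _))

theorem resolutionDiff_comparison (i : ℕ)
    (v : (resolution K w' 𝓜 (i + 1)).gens →₀ MvPolynomial τ K) :
    resolutionDiff K w 𝓜' i (h.comparison (i + 1) v) =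
      h.comparison i (resolutionDiff K w' 𝓜 i v) :=
  h.resolutionDiff_comparison_of_mem_syz (h.comparison_mem_syz i) v

end StrandEquiv

section Exactness

variable {K : Type u} [Field K] {σ A : Type} [AddCommGroup A] {w : σ → A}
  {M : Type u} [AddCommGroup M] [Module (MvPolynomial σ K) M] {𝓜 : A → AddSubgroup M}
  {J : Set σ} {a : A} {i : ℕ}

theorem exists_reducedDiff_eq {v : (resolution K w 𝓜 i).gens →₀ MvPolynomial σ K}
    (hv : (resolution K w 𝓜 i).IsHomogeneous w v a) (hsyz : v ∈ (resolution K w 𝓜 i).syz) :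
    ∃ z, reducedDiff K w 𝓜 J a i z = Subquotient.mk _ ⟨v, hv⟩ :=
  ⟨Subquotient.mk _ ⟨(resolution K w 𝓜 i).cover w a v, Stage.isHomogeneous_cover v⟩,
    congrArg (Subquotient.mk _) (Subtype.ext (Stage.diff_cover hsyz hv))⟩

theorem eq_zero_of_reducedPiece_mk_eq_zero (hJ : J = ∅)
    {v : (resolution K w 𝓜 i).homogeneousSubmodule w a}
    (h : (Subquotient.mk _ v : ReducedPiece K w 𝓜 J a i) = 0) : v.1 = 0 := by
  subst hJ
  have hmem : v.1 ∈ varSubmodule K ∅ _ := Subquotient.mk_eq_zero.1 h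
  rwa [varSubmodule_empty, Submodule.mem_bot] at hmem

theorem exactAt_reducedComplex_empty (hJ : J = ∅) (a : A) (i : ℕ) :
    (reducedComplex K w 𝓜 J a).ExactAt (i + 1) := by
  rw [HomologicalComplex.exactAt_iff' _ (i + 2) (i + 1) i (by simp) (by simp),
    ShortComplex.moduleCat_exact_iff]
  intro x hx
  obtain ⟨v, rfl⟩ := reducedComplex_exists_rep x
  change (reducedComplex K w 𝓜 J a).d (i + 1) i _ = 0 at hx
  change ∃ y, (reducedComplex K w 𝓜 J a).d (i + 2) (i + 1) y = _
  rw [reducedComplex_d] at hx ⊢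
  exact exists_reducedDiff_eq v.2 (eq_zero_of_reducedPiece_mk_eq_zero hJ hx)

end Exactness

namespace StrandEquiv

variable {K : Type u} [Field K] {τ σ A' A : Type} [AddCommGroup A'] [AddCommGroup A]
  {w' : τ → A'} {w : σ → A} {M : Type u} [AddCommGroup M] [Module (MvPolynomial τ K) M]
  {M' : Type u} [AddCommGroup M'] [Module (MvPolynomial σ K) M'] {𝓜 : A' → AddSubgroup M}
  {𝓜' : A → AddSubgroup M'} (h : StrandEquiv (K := K) w' w 𝓜 𝓜') {a b : A'}

/-- The comparison map of canonical resolutions, modulo variables and in a fixed degree. -/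
def reducedComparison (J : Set τ) (a : A') :
    reducedComplex K w' 𝓜 J a ⟶ reducedComplex K w 𝓜' (h.var '' J) (h.degree a) :=
  reducedMap h.comparison (fun i _ => h.isHomogeneous_comparison i)
    (fun _ _ => renameCombination_mem_varSubmodule) h.resolutionDiff_comparison

theorem augmentation_mem (h : StrandEquiv (K := K) w' w 𝓜 𝓜')
    {v : (resolution K w 𝓜' 0).gens →₀ MvPolynomial σ K} {c : A}
    (hv : (resolution K w 𝓜' 0).IsHomogeneous w v c) : augmentation K w 𝓜' v ∈ 𝓜' c := by
  rw [augmentation, Finsupp.linearCombination_apply]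
  refine (𝓜' c).sum_mem fun g _ => ?_
  have := h.smul_mem (hv g) g.2.2
  change _ ∈ 𝓜' (c - g.1.1 + g.1.1) at this
  rwa [sub_add_cancel] at this

theorem exists_sub_comparison_mem_syz {u : (resolution K w 𝓜' 0).gens →₀ MvPolynomial σ K}
    (hu : (resolution K w 𝓜' 0).IsHomogeneous w u (h.degree a)) :
    ∃ v, (resolution K w' 𝓜 0).IsHomogeneous w' v a ∧
      u - h.comparison 0 v ∈ (resolution K w 𝓜' 0).syz := by
  have hm := h.augmentation_mem hu
  rw [degree, ← h.map_piece] at hm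
  obtain ⟨m, hm, hmu⟩ := hm
  refine ⟨firstCover K w' 𝓜 a m, isHomogeneous_firstCover, ?_⟩
  change augmentation K w 𝓜' _ = 0
  rw [map_sub, h.augmentation_comparison, augmentation_firstCover hm, sub_eq_zero]
  exact hmu.symm

theorem mem_syz_of_comparison_mem_syz {v : (resolution K w' 𝓜 0).gens →₀ MvPolynomial τ K}
    (hv : h.comparison 0 v ∈ (resolution K w 𝓜' 0).syz) : v ∈ (resolution K w' 𝓜 0).syz :=
  h.map_injective ((h.augmentation_comparison v).symm.trans (hv.trans (map_zero h.map).symm))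

theorem quasiIsoAt_reducedComparison_empty_zero (a : A') :
    QuasiIsoAt (h.reducedComparison ∅ a) 0 := by
  rw [ChainComplex.quasiIsoAt₀_iff]
  refine quasiIso_of_elementwise _ ?_ ?_
  · intro x y _ hxy
    obtain ⟨v, rfl⟩ := reducedComplex_exists_rep x
    obtain ⟨u, rfl⟩ := reducedComplex_exists_rep y
    change (reducedComplex K w 𝓜' (h.var '' ∅) (h.degree a)).d 1 0 _ = _ at hxy
    change ∃ z, (reducedComplex K w' 𝓜 ∅ a).d 1 0 z = _
    rw [reducedComplex_d] at hxy ⊢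
    have hsub : resolutionDiff K w 𝓜' 0 u.1 - h.comparison 0 v.1 = 0 :=
      eq_zero_of_reducedPiece_mk_eq_zero (Set.image_empty _) (sub_eq_zero.2 hxy)
    refine exists_reducedDiff_eq v.2 (h.mem_syz_of_comparison_mem_syz ?_)
    exact sub_eq_zero.1 hsub ▸ Stage.diff_mem_syz w u.1
  · intro y _
    obtain ⟨u, rfl⟩ := reducedComplex_exists_rep y
    obtain ⟨v, hv, hsyz⟩ := h.exists_sub_comparison_mem_syz u.2
    obtain ⟨z, hz⟩ := exists_reducedDiff_eq (J := h.var '' ∅)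
      (sub_mem u.2 (h.isHomogeneous_comparison 0 hv)) hsyz
    refine ⟨Subquotient.mk _ ⟨v, hv⟩, z, ?_, ?_⟩
    · change (reducedComplex K w' 𝓜 ∅ a).d 0 0 _ = 0
      rw [HomologicalComplex.shape _ _ _ (by simp)]
      rfl
    · change _ + (reducedComplex K w 𝓜' (h.var '' ∅) (h.degree a)).d 1 0 z = _
      rw [reducedComplex_d]
      change (Subquotient.mk _ ⟨h.comparison 0 v, _⟩ : ReducedPiece K w 𝓜' _ _ 0) +
        reducedDiff K w 𝓜' _ _ 0 z = _
      rw [hz]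
      exact congrArg (Subquotient.mk _) (Subtype.ext (add_sub_cancel _ _))

theorem quasiIso_reducedComparison_empty (a : A') : QuasiIso (h.reducedComparison ∅ a) := by
  refine ⟨fun i => ?_⟩
  cases i with
  | zero => exact h.quasiIsoAt_reducedComparison_empty_zero a
  | succ i =>
    rw [quasiIsoAt_iff_exactAt _ _ (exactAt_reducedComplex_empty rfl a i)]
    exact exactAt_reducedComplex_empty (Set.image_empty _) _ i

/-- The comparison map between the short exact sequences which kill a variable on both sides. -/
def variableSequenceMap (J : Set τ) {s : τ} (hab : w' s + b = a) :
    variableSequence K 𝓜 (J := J) (J' := insert s J) rfl hab ⟶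
      variableSequence K 𝓜' (J := h.var '' J) (J' := h.var '' insert s J)
        Set.image_insert_eq.symm (h.weight_var_add_degree hab) where
  τ₁ := h.reducedComparison J b
  τ₂ := h.reducedComparison J a
  τ₃ := h.reducedComparison (insert s J) a
  comm₁₂ := by
    ext i x
    obtain ⟨v, rfl⟩ := reducedComplex_exists_rep x
    refine congrArg (Subquotient.mk _) (Subtype.ext ?_)
    have := renameCombination_smul (φ := h.var) (e := h.comparisonGen i) (X s) v.1
    rw [rename_X] at this
    exact this.symm
  comm₂₃ := by
    ext i x
    obtain ⟨v, rfl⟩ := reducedComplex_exists_rep x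
    rfl

theorem quasiIso_reducedComparison {J : Set τ} (hJ : J.Finite) :
    ∀ a, QuasiIso (h.reducedComparison J a) := by
  induction J, hJ using Set.Finite.induction_on with
  | empty => exact h.quasiIso_reducedComparison_empty
  | @insert s J hs _ ih =>
    intro a
    have hab : w' s + (a - w' s) = a := add_sub_cancel _ _
    exact HomologicalComplex.HomologySequence.quasiIso_τ₃ (h.variableSequenceMap J hab)
      (variableSequence_shortExact hs rfl hab)
      (variableSequence_shortExact (h.var_injective.mem_set_image.not.2 hs) _ _) (ih _) (ih a)

theorem betti_eq_reducedBetti_range [Finite τ] (i : ℕ) (a : A') :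
    betti K w' 𝓜 i a = reducedBetti K w 𝓜' (Set.range h.var) i (h.degree a) := by
  have := h.quasiIso_reducedComparison Set.finite_univ a
  rw [betti_eq_reducedBetti, ← Set.image_univ]
  exact (isoOfQuasiIsoAt (h.reducedComparison Set.univ a) i).toLinearEquiv.rank_eq

end StrandEquiv

/-! ### Killing variables of the same degree -/

section Vanishing

variable {K : Type u} [Field K] {σ A : Type} [AddCommGroup A] {w : σ → A} {ℓ : A →+ ℤ}
  {M : Type u} [AddCommGroup M] [Module (MvPolynomial σ K) M] {𝓜 : A → AddSubgroup M}

theorem nonneg_of_isWeightedHomogeneous (hw : ∀ s, 0 ≤ ℓ (w s)) {p : MvPolynomial σ K} {a : A}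
    (hp : IsWeightedHomogeneous w p a) (h0 : p ≠ 0) : 0 ≤ ℓ a := by
  obtain ⟨m, hm⟩ := ne_zero_iff.1 h0
  rw [← hp hm, Finsupp.weight_apply, map_finsuppSum]
  refine Finset.sum_nonneg fun s _ => ?_
  simpa only [map_nsmul] using nsmul_nonneg (hw s) (m s)

theorem Stage.nonneg_of_isHomogeneous {T : Stage K σ A} (hw : ∀ s, 0 ≤ ℓ (w s))
    (hT : ∀ g, 0 ≤ ℓ (T.deg g)) {v : T.gens →₀ MvPolynomial σ K} {a : A}
    (hv : T.IsHomogeneous w v a) (h0 : v ≠ 0) : 0 ≤ ℓ a := by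
  obtain ⟨g, hg⟩ := Finsupp.ne_iff.1 h0
  have := nonneg_of_isWeightedHomogeneous hw (hv g) hg
  rw [map_sub, sub_nonneg] at this
  exact (hT g).trans this

theorem nonneg_deg_resolution (hw : ∀ s, 0 ≤ ℓ (w s))
    (h𝓜 : ∀ a, ∀ m ∈ 𝓜 a, m ≠ 0 → 0 ≤ ℓ a) (i : ℕ) (g : (resolution K w 𝓜 i).gens) :
    0 ≤ ℓ ((resolution K w 𝓜 i).deg g) := by
  induction i with
  | zero => exact h𝓜 _ _ g.2.2 g.2.1
  | succ i ih => exact Stage.nonneg_of_isHomogeneous hw ih g.2.2.2 g.2.1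

theorem reducedBetti_eq_zero (hw : ∀ s, 0 ≤ ℓ (w s))
    (h𝓜 : ∀ a, ∀ m ∈ 𝓜 a, m ≠ 0 → 0 ≤ ℓ a) (J : Set σ) (i : ℕ) {a : A} (ha : ℓ a < 0) :
    reducedBetti K w 𝓜 J i a = 0 := by
  have hzero (x : (reducedComplex K w 𝓜 J a).X i) : x = 0 := by
    obtain ⟨v, rfl⟩ := reducedComplex_exists_rep x
    have hv : v = 0 := by
      by_contra h0
      exact ha.not_ge (Stage.nonneg_of_isHomogeneous hw (nonneg_deg_resolution hw h𝓜 i) v.2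
        fun h => h0 (Subtype.ext h))
    rw [hv]
    rfl
  have hX : Subsingleton ((reducedComplex K w 𝓜 J a).sc i).X₂ := subsingleton_of_forall_eq 0 hzero
  have hH : Subsingleton ((reducedComplex K w 𝓜 J a).homology i) :=
    ModuleCat.subsingleton_of_isZero
      (ShortComplex.isZero_homology_of_isZero_X₂ _ (ModuleCat.isZero_of_subsingleton _))
  exact rank_subsingleton' K _

end Vanishing

section Multichoose

theorem le_sum_multichoose_succ {R : Type*} [Semiring R] [PartialOrder R] [IsOrderedAddMonoid R]
    {h h' b : ℕ → R} {n : ℕ} (h0 : h 0 ≤ h' 0)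
    (hs : ∀ d, h (d + 1) ≤ h d + h' (d + 1))
    (hb : ∀ d, h' d ≤ ∑ m ∈ Finset.range (d + 1), (n.multichoose (d - m) : R) * b m)
    (d : ℕ) :
    h d ≤ ∑ m ∈ Finset.range (d + 1), ((n + 1).multichoose (d - m) : R) * b m := by
  induction d with
  | zero => simpa using h0.trans (hb 0)
  | succ d ih =>
    have hpascal (m : ℕ) (hm : m ∈ Finset.range (d + 1)) :
        ((n + 1).multichoose (d - m) : R) * b m +
          (n.multichoose (d + 1 - m) : R) * b m =
            ((n + 1).multichoose (d + 1 - m) : R) * b m := by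
      rw [Nat.succ_sub (Finset.mem_range_succ_iff.1 hm), Nat.multichoose_succ_succ, Nat.cast_add,
        add_mul, add_comm]
    refine (hs d).trans ((add_le_add ih (hb (d + 1))).trans_eq ?_)
    rw [Finset.sum_range_succ _ (d + 1), Finset.sum_range_succ _ (d + 1), ← add_assoc,
      ← Finset.sum_add_distrib, Finset.sum_congr rfl hpascal, Nat.sub_self,
      Nat.multichoose_zero_right, Nat.multichoose_zero_right]

variable {K : Type u} [Field K] {σ A : Type} [AddCommGroup A] {w : σ → A} {ℓ : A →+ ℤ}
  {M : Type u} [AddCommGroup M] [Module (MvPolynomial σ K) M] {𝓜 : A → AddSubgroup M}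

theorem reducedBetti_compl_le (hw : ∀ s, 0 ≤ ℓ (w s)) (h𝓜 : ∀ a, ∀ m ∈ 𝓜 a, m ≠ 0 → 0 ≤ ℓ a)
    {δ a₀ : A} (hδ : ℓ a₀ < ℓ δ) (i : ℕ) (U : Finset σ) (hU : ∀ s ∈ U, w s = δ) (d : ℕ) :
    reducedBetti K w 𝓜 (U : Set σ)ᶜ i (a₀ + d • δ) ≤
      ∑ m ∈ Finset.range (d + 1), (U.card.multichoose (d - m) : Cardinal.{u}) *
        betti K w 𝓜 i (a₀ + m • δ) := by
  classical
  induction U using Finset.induction_on generalizing d with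
  | empty =>
    rw [Finset.coe_empty, Set.compl_empty, ← betti_eq_reducedBetti]
    have hle := Finset.single_le_sum_of_canonicallyOrdered (Finset.self_mem_range_succ d)
      (f := fun m => ((Finset.card (∅ : Finset σ)).multichoose (d - m) : Cardinal.{u}) *
        betti K w 𝓜 i (a₀ + m • δ))
    simpa using hle
  | insert s U hs ih =>
    have hsU : insert s ((insert s U : Finset σ) : Set σ)ᶜ = (U : Set σ)ᶜ := by
      ext t
      by_cases h : t = s <;> simp [h, hs]
    have hstep {a b : A} (hab : δ + b = a) := reducedBetti_le_add (K := K) (w := w) (𝓜 := 𝓜)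
      (J := ((insert s U : Finset σ) : Set σ)ᶜ) (s := s) (by simp)
      ((hU s (Finset.mem_insert_self s U)).symm ▸ hab) i
    rw [hsU] at hstep
    rw [Finset.card_insert_of_notMem hs]
    refine le_sum_multichoose_succ (h := fun d => reducedBetti K w 𝓜
      ((insert s U : Finset σ) : Set σ)ᶜ i (a₀ + d • δ)) (b := fun m => betti K w 𝓜 i (a₀ + m • δ))
      ?_ (fun d => hstep ?_) (fun d => ih (fun t ht => hU t (Finset.mem_insert_of_mem ht)) d) d
    · refine (hstep (add_sub_cancel δ _)).trans_eq ?_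
      rw [reducedBetti_eq_zero hw h𝓜 _ _ (by simpa using hδ), zero_add]
    · rw [succ_nsmul, add_left_comm, add_comm (d • δ)]

end Multichoose

/-! ### The strands of the Rees algebra -/

section ReesStrand

variable {K : Type u} [Field K] {N k : ℕ} (f : Fin (k + 1) → MvPolynomial (Fin N) K)

/-- The inclusion of the Rees algebra in `R[t]`. -/
def Rees.val : Rees f →+* Polynomial (MvPolynomial (Fin N) K) :=
  (reesAlgebra (Ideal.span (Set.range f))).val.toRingHom

theorem Rees.val_injective : Function.Injective (Rees.val f) := Subtype.val_injective

/-- The presentation of the Rees algebra, as a map to `R[t]`. -/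
def Rees.presentationVal :
    MvPolynomial (Fin N ⊕ Fin (k + 1)) K →+* Polynomial (MvPolynomial (Fin N) K) :=
  (Rees.val f).comp (Rees.presentation f)

theorem Rees.presentationVal_C (c : K) : presentationVal f (C c) = Polynomial.C (C c) :=
  congrArg (Rees.val f) (eval₂Hom_C _ _ c)

theorem Rees.presentationVal_inl (s : Fin N) :
    presentationVal f (X (Sum.inl s)) = Polynomial.C (X s) :=
  congrArg (Rees.val f) (eval₂Hom_X' _ _ (Sum.inl s))

theorem Rees.presentationVal_inr (l : Fin (k + 1)) :
    presentationVal f (X (Sum.inr l)) = Polynomial.monomial 1 (f l) :=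
  congrArg (Rees.val f) (eval₂Hom_X' _ _ (Sum.inr l))

theorem Rees.presentationVal_rename (p : MvPolynomial (Fin N) K) :
    presentationVal f (rename Sum.inl p) = Polynomial.C p := by
  induction p using MvPolynomial.induction_on with
  | C c => rw [rename_C, presentationVal_C]
  | add p q hp hq => simp only [map_add, hp, hq]
  | mul_X p s hp => simp only [map_mul, hp, rename_X, presentationVal_inl]

theorem Rees.presentation_surjective : Function.Surjective (Rees.presentation f) := by
  let B : Subalgebra (MvPolynomial (Fin N) K) (Polynomial (MvPolynomial (Fin N) K)) :=
    { (presentationVal f).range with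
      algebraMap_mem' := fun p => ⟨rename Sum.inl p, presentationVal_rename f p⟩ }
  have hspan : Ideal.span (Set.range f) ≤ (Subalgebra.toSubmodule B).comap
      (Polynomial.monomial 1) := by
    refine Submodule.span_le.2 ?_
    rintro _ ⟨l, rfl⟩
    exact ⟨X (Sum.inr l), presentationVal_inr f l⟩
  have hB : reesAlgebra (Ideal.span (Set.range f)) ≤ B := by
    rw [← adjoin_monomial_eq_reesAlgebra]
    refine Algebra.adjoin_le ?_
    rintro _ ⟨m, hm, rfl⟩
    exact hspan hm
  intro x
  obtain ⟨q, hq⟩ := hB x.2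
  exact ⟨q, Rees.val_injective f hq⟩

variable {f} {r : ℕ}

theorem isWeightedHomogeneous_intCast {p : MvPolynomial (Fin N) K} (hp : p.IsHomogeneous r) :
    IsWeightedHomogeneous (fun _ : Fin N => (1 : ℤ)) p r := by
  have := isWeightedHomogeneous_rename (φ := id) (w := fun _ : Fin N => (1 : ℤ))
    (β := Nat.castAddMonoidHom ℤ) (fun _ => Nat.cast_one.symm) hp
  rwa [rename_id_apply] at this

theorem Rees.exists_presentationVal_monomial (hf : ∀ l, (f l).IsHomogeneous r)
    (μ : Fin N ⊕ Fin (k + 1) →₀ ℕ) (c : K) :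
    ∃ (j : ℤ) (e : ℕ) (y : MvPolynomial (Fin N) K),
      IsWeightedHomogeneous (bideg N k) (monomial μ c) (j, (e : ℤ)) ∧
      IsWeightedHomogeneous (fun _ => (1 : ℤ)) y (j + r * e) ∧
      presentationVal f (monomial μ c) = Polynomial.monomial e y := by
  refine induction_on_monomial (motive := fun p => ∃ (j : ℤ) (e : ℕ)
    (y : MvPolynomial (Fin N) K), IsWeightedHomogeneous (bideg N k) p (j, (e : ℤ)) ∧
      IsWeightedHomogeneous (fun _ => (1 : ℤ)) y (j + r * e) ∧
      presentationVal f p = Polynomial.monomial e y)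
    (fun c => ⟨0, 0, C c, isWeightedHomogeneous_C _ _, ?_, presentationVal_C f c⟩) ?_ μ c
  · simpa only [Nat.cast_zero, mul_zero, add_zero] using isWeightedHomogeneous_C _ c
  · rintro p s ⟨j, e, y, hp, hy, hval⟩
    have hps := hp.mul (isWeightedHomogeneous_X K (bideg N k) s)
    rcases s with s | l
    · refine ⟨j + 1, e, y * X s, ?_, ?_, ?_⟩
      · simpa [bideg] using hps
      · rw [add_right_comm]
        exact hy.mul (isWeightedHomogeneous_X K _ s)
      · rw [map_mul, hval, presentationVal_inl, Polynomial.monomial_mul_C]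
    · refine ⟨j, e + 1, y * f l, ?_, ?_, ?_⟩
      · simpa [bideg] using hps
      · rw [Nat.cast_add_one, mul_add_one, ← add_assoc]
        exact hy.mul (isWeightedHomogeneous_intCast (hf l))
      · rw [map_mul, hval, presentationVal_inr, Polynomial.monomial_mul_monomial]

theorem Rees.presentationVal_component (hf : ∀ l, (f l).IsHomogeneous r) (n : ℤ) (d : ℕ)
    (q : MvPolynomial (Fin N ⊕ Fin (k + 1)) K) :
    presentationVal f (weightedHomogeneousComponent (bideg N k) (n - r * d, (d : ℤ)) q) =
      Polynomial.monomial d (weightedHomogeneousComponent (fun _ => (1 : ℤ)) n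
        ((presentationVal f q).coeff d)) := by
  induction q using MvPolynomial.induction_on' with
  | monomial μ c =>
    obtain ⟨j, e, y, hμ, hy, hval⟩ := exists_presentationVal_monomial hf μ c
    rw [hval, Polynomial.coeff_monomial]
    by_cases hed : e = d
    · subst hed
      rw [if_pos rfl]
      by_cases hn : j + r * e = n
      · rw [← hn, add_sub_cancel_right, weightedHomogeneousComponent_eq_self hμ, hval,
          weightedHomogeneousComponent_eq_self hy]
      · rw [hy.weightedHomogeneousComponent_ne n (Ne.symm hn),
          hμ.weightedHomogeneousComponent_ne _ fun h => hn (by grind), map_zero, map_zero]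
    · rw [if_neg hed, hμ.weightedHomogeneousComponent_ne _ fun h => hed (by grind),
        map_zero, map_zero, map_zero]
  | add p q hp hq => simp only [map_add, Polynomial.coeff_add, hp, hq]

theorem Rees.val_smul (q : MvPolynomial (Fin N ⊕ Fin (k + 1)) K) (x : Rees f) :
    Rees.val f (q • x) = Rees.presentationVal f q * Rees.val f x :=
  map_mul (Rees.val f) (Rees.presentation f q) x

variable (f) in
/-- The identification of `I^d` with `I^d t^d`. -/
def powToRees (d : ℕ) : ↥(Ideal.span (Set.range f) ^ d) →+ Rees f where
  toFun m := ⟨Polynomial.monomial d m.1, reesAlgebra.monomial_mem.2 m.2⟩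
  map_zero' := Subtype.ext (map_zero (Polynomial.monomial d))
  map_add' m m' := Subtype.ext (map_add (Polynomial.monomial d) m.1 m'.1)

theorem Rees.val_powToRees {d : ℕ} (m : ↥(Ideal.span (Set.range f) ^ d)) :
    Rees.val f (powToRees f d m) = Polynomial.monomial d m.1 := rfl

theorem map_powToRees_idealPiece (hf : ∀ l, (f l).IsHomogeneous r) (d : ℕ) (n : ℤ) :
    (idealPiece (Ideal.span (Set.range f) ^ d) n).map (powToRees f d) =
      reesPiece f (n - r * d, (d : ℤ)) := by
  ext x
  constructor
  · rintro ⟨m, hm, rfl⟩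
    have hm : IsWeightedHomogeneous (fun _ => (1 : ℤ)) m.1 n := hm
    obtain ⟨q, hq⟩ := Rees.presentation_surjective f (powToRees f d m)
    have hval : Rees.presentationVal f q = Polynomial.monomial d m.1 := congrArg (Rees.val f) hq
    refine ⟨weightedHomogeneousComponent (bideg N k) (n - r * d, (d : ℤ)) q,
      weightedHomogeneousComponent_isWeightedHomogeneous _ _, Rees.val_injective f ?_⟩
    refine (Rees.presentationVal_component hf n d q).trans ?_
    rw [hval, Polynomial.coeff_monomial_same, weightedHomogeneousComponent_eq_self hm,
      Rees.val_powToRees]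
  · rintro ⟨q, hq, rfl⟩
    have hq : IsWeightedHomogeneous (bideg N k) q (n - r * d, (d : ℤ)) := hq
    have hval := Rees.presentationVal_component hf n d q
    rw [weightedHomogeneousComponent_eq_self hq] at hval
    have hmem : Rees.presentationVal f q ∈ reesAlgebra (Ideal.span (Set.range f)) :=
      (Rees.presentation f q).2
    rw [hval, reesAlgebra.monomial_mem] at hmem
    exact ⟨⟨_, hmem⟩, weightedHomogeneousComponent_isWeightedHomogeneous _ _,
      Rees.val_injective f hval.symm⟩

/-- The identification of `I^d` with the strand of the Rees algebra in `t`-degree `d`. -/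
def powStrandEquiv (hf : ∀ l, (f l).IsHomogeneous r) (d : ℕ) :
    StrandEquiv (K := K) (fun _ : Fin N => (1 : ℤ)) (bideg N k)
      (idealPiece (Ideal.span (Set.range f) ^ d)) (reesPiece f) where
  var := Sum.inl
  deg := AddMonoidHom.inl ℤ ℤ
  shift := (-(r * d), d)
  map := powToRees f d
  var_injective := Sum.inl_injective
  weight_var _ := rfl
  map_smul p m := by
    apply Rees.val_injective f
    rw [Rees.val_smul, Rees.presentationVal_rename, Rees.val_powToRees, Rees.val_powToRees,
      Polynomial.C_mul_monomial]
    rfl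
  map_injective m m' h :=
    Subtype.ext (Polynomial.monomial_injective d (congrArg (Rees.val f) h))
  map_piece n := by
    rw [map_powToRees_idealPiece hf, AddMonoidHom.inl_apply, Prod.mk_add_mk, ← sub_eq_add_neg,
      zero_add]
  smul_mem := by
    rintro a b p hp _ ⟨q, hq, rfl⟩
    exact ⟨p * q, hp.mul hq, map_mul (Rees.presentation f) p q⟩

theorem snd_bideg_nonneg (s : Fin N ⊕ Fin (k + 1)) : 0 ≤ (bideg N k s).2 := by
  cases s <;> simp [bideg]

theorem snd_nonneg_of_mem_reesPiece (a : ℤ × ℤ) (x : Rees f) (hx : x ∈ reesPiece f a)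
    (h0 : x ≠ 0) : 0 ≤ a.2 := by
  obtain ⟨q, hq, rfl⟩ := hx
  refine nonneg_of_isWeightedHomogeneous (ℓ := AddMonoidHom.snd ℤ ℤ) snd_bideg_nonneg hq ?_
  rintro rfl
  exact h0 (map_zero (Rees.presentation f))

end ReesStrand

end GradedBetti

end

theorem theorem3p1 {K : Type u} [Field K] (N k r : ℕ)
    (f : Fin (k + 1) → MvPolynomial (Fin N) K) (hf : ∀ i, (f i).IsHomogeneous r)
    (i d : ℕ) (j : ℤ) :
    GradedBetti.idealBetti (Ideal.span (Set.range f) ^ d) i (j + r * d) ≤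
      ∑ m ∈ Finset.range (d + 1),
        ((d + k - m).choose (d - m) : Cardinal.{u}) * GradedBetti.reesBetti f i (j, m) := by
  let U : Finset (Fin N ⊕ Fin (k + 1)) := Finset.univ.map Function.Embedding.inr
  have hdeg (m : ℕ) : ((j, 0) : ℤ × ℤ) + m • (0, 1) = (j, (m : ℤ)) := by simp
  have hchoose {m : ℕ} (hm : m ∈ Finset.range (d + 1)) :
      U.card.multichoose (d - m) = (d + k - m).choose (d - m) := by
    have := Finset.mem_range_succ_iff.1 hm
    rw [Finset.card_map, Finset.card_fin, Nat.multichoose_eq]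
    congr 1
    omega
  calc GradedBetti.idealBetti (Ideal.span (Set.range f) ^ d) i (j + r * d)
    _ = GradedBetti.reducedBetti K (GradedBetti.bideg N k) (GradedBetti.reesPiece f)
          (U : Set (Fin N ⊕ Fin (k + 1)))ᶜ i ((j, 0) + d • (0, 1)) := by
      rw [GradedBetti.idealBetti,
        (GradedBetti.powStrandEquiv hf d).betti_eq_reducedBetti_range]
      congr 1
      · ext s; cases s <;> simp [U, GradedBetti.powStrandEquiv]
      · simp [GradedBetti.StrandEquiv.degree, GradedBetti.powStrandEquiv]
    _ ≤ _ := GradedBetti.reducedBetti_compl_le (ℓ := AddMonoidHom.snd ℤ ℤ)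
      GradedBetti.snd_bideg_nonneg GradedBetti.snd_nonneg_of_mem_reesPiece zero_lt_one i U
      (by simp [U, GradedBetti.bideg]) d
    _ = _ := Finset.sum_congr rfl fun m hm => by rw [hchoose hm, hdeg]; rfl
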